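/- Let $f:\mathbb R^n\to\mathbb R^n$ be continuously differentiable, let $g:\mathbb R^n\to\mathbb R^s$ be twice continuously differentiable, let $D\subseteq\mathbb R^s$ be a convex polyhedral set, and let $\hat\gamma>0$. All spaces and products carry the Euclidean norm. $N_D(d)$ denotes the normal cone of convex analysis ($\emptyset$ if $d\notin D$), and $\nabla$ denotes the Jacobian. Consider the set-valued mapping $F:\mathbb R^n\times\mathbb R^s\rightrightarrows\mathbb R^n\times\mathbb R^s$, $$F(x,d)=\begin{pmatrix} f(x)+\nabla g(x)^T N_D(d)\\ g(x)-d\end{pmatrix},$$ so that $0\in F(\bar x,g(\bar x))$ if and only if $0\in f(\bar x)+\nabla g(\bar x)^TN_D(g(\bar x))$. For $\lambda\in\mathbb R^s$ put $\mathcal L_\lambda(x)=f(x)+\nabla g(x)^T\lambda$. For $(d,\lambda)\in\operatorname{gph}N_D$ let $\widehat D^*N_D(d,\lambda)$ be the regular (Fréchet) coderivative: $u^*\in\widehat D^*N_D(d,\lambda)(v^*)$ if and only if $(u^*,-v^*)$ lies in the regular normal cone to $\operatorname{gph}N_D$ at $(d,\lambda)$, i.e. in the negative polar of the tangent (Bouligand)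 cone to $\operatorname{gph}N_D$ at $(d,\lambda)$. Set $$T(x,d,\lambda)(p,q^*)=\{(\nabla\mathcal L_\lambda(x)^Tp+\nabla g(x)^Tq^*,\,d^*)\mid d^*+q^*\in\widehat D^*N_D(d,\lambda)(\nabla g(x)p)\}.$$ Call $(x,d)$ non-degenerate with modulus $\hat\gamma$ if $\|\nabla g(x)^T\mu\|\ge\hat\gamma\|\mu\|$ for all $\mu\in\operatorname{span}N_D(d)$. If $\hat z=((x,d),(p^*,g(x)-d))\in\operatorname{gph}F$ and $(x,d)$ is non-degenerate with modulus $\hat\gamma$, then there is exactly one $\lambda\in N_D(d)$ with $p^*=\mathcal L_\lambda(x)$, denoted $\hat\lambda(x,d,p^*)$. For $\hat z=((x,d),(p^*,g(x)-d))\in\operatorname{gph}F$ define $$\widehat{\mathcal D}^*F(\hat z)(p,q^*)=\begin{cases}T(x,d,\hat\lambda(x,d,p^*))(p,q^*)&\text{if }(x,d)\text{ is non-degenerate with modulus }\hat\gamma,\\ \{(0,0)\}&\text{if }(x,d)\text{ is not non-degenerate with modulus }\hat\gamma\text{ and }(p,q^*)=(0,0),\\ \emptyset&\text{otherwise,}\end{cases}$$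 and let $\mathcal D^*F$ be the associated limiting mapping, $\operatorname{gph}\mathcal D^*F(\hat z)=\limsup_{\hat z'\to\hat z,\ \hat z'\in\operatorname{gph}F}\operatorname{gph}\widehat{\mathcal D}^*F(\hat z')$. Theorem. For every $\bar x\in\mathbb R^n$ with $0\in F(\bar x,g(\bar x))$, the mapping $F$ is semismooth$^*$ with respect to $\mathcal D^*F$ at $((\bar x,g(\bar x)),(0,0))$. By definition this means: for every $\epsilon>0$ there is $\delta>0$ such that, with $\bar z=(\bar x,g(\bar x))$, $$|\langle z^*,z-\bar z\rangle-\langle y^*,y\rangle|\le\epsilon\,\|(z-\bar z,\,y)\|\,\|(z^*,y^*)\|$$ for all $(z,y)\in\operatorname{gph}F$ with $\|(z-\bar z,y)\|\le\delta$ and all $(y^*,z^*)\in\operatorname{gph}\widehat{\mathcal D}^*F(z,y)$. No constraint qualification is assumed. -/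

import Mathlib

open scoped RealInnerProductSpace

noncomputable section

namespace SemismoothStar

/-! ### Variational geometry in real inner product spaces -/

section General

variable {V W : Type*} [NormedAddCommGroup V] [InnerProductSpace ℝ V]
  [NormedAddCommGroup W] [InnerProductSpace ℝ W]

/-- The pair `(v, w)` in the product space, which carries the Euclidean product norm
`‖(v, w)‖ = √(‖v‖² + ‖w‖²)`. -/
abbrev pair (v : V) (w : W) : WithLp 2 (V × W) := WithLp.toLp 2 (v, w)

/-- The graph `{(v, w) | w ∈ F v}` of a set-valued mapping `F : V ⇉ W`. -/
def gph (F : V → Set W) : Set (WithLp 2 (V × W)) := {z | z.snd ∈ F z.fst}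

/-- The regular (Fréchet) normal cone: the negative polar of the tangent (Bouligand) cone.
Mathlib's `posTangentConeAt A x` consists of the limits of `c • d` with `c ≥ 0`, `d → 0` and
`x + d ∈ A`, which for `x ∈ A` is the Bouligand cone. It is only used at points `x ∈ A`. -/
def regularNormalCone (A : Set V) (x : V) : Set V :=
  {ξ | ∀ u ∈ posTangentConeAt A x, ⟪ξ, u⟫ ≤ 0}

/-- The regular (Fréchet) coderivative of `F : V ⇉ W` at `(x, y) ∈ gph F`:
`u' ∈ D̂*F(x, y)(v')` iff `(u', -v')` is a regular normal to `gph F` at `(x, y)`. -/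
def regularCoderivative (F : V → Set W) (x : V) (y : W) (v' : W) : Set V :=
  {u' | pair u' (-v') ∈ regularNormalCone (gph F) (pair x y)}

/-- The normal cone mapping of convex analysis, `N_D : V ⇉ V`; it is empty outside of `D`. -/
def normalCone (D : Set V) (d : V) : Set V :=
  {μ | d ∈ D ∧ ∀ e ∈ D, ⟪μ, e - d⟫ ≤ 0}

/-- Convex polyhedral sets: intersections of finitely many closed half-spaces. -/
def IsConvexPolyhedral (D : Set V) : Prop :=
  ∃ (m : ℕ) (a : Fin m → V) (b : Fin m → ℝ), D = {d | ∀ i, ⟪a i, d⟫ ≤ b i}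

/-- Semismoothness* of `F : V ⇉ W` at `(x₀, y₀) ∈ gph F` in the generalized sense, with respect to
a mapping `Dhat` that assigns to each `(x, y) ∈ gph F` a set-valued mapping
`Dhat x y : W ⇉ V` whose graph is a cone. The values of `Dhat` outside of `gph F` play no role. -/
def IsSemismoothStarWrt (F : V → Set W) (Dhat : V → W → W → Set V) (x₀ : V) (y₀ : W) : Prop :=
  ∀ ε > 0, ∃ δ > 0, ∀ (x : V) (y : W), y ∈ F x → ‖pair (x - x₀) (y - y₀)‖ ≤ δ →
    ∀ (y' : W) (x' : V), x' ∈ Dhat x y y' →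
      |⟪x', x - x₀⟫ - ⟪y', y - y₀⟫| ≤ ε * ‖pair (x - x₀) (y - y₀)‖ * ‖pair x' y'‖

end General

/-! ### The generalized equation -/

section GE

variable {n s : ℕ}

local notation "ℝⁿ" => EuclideanSpace ℝ (Fin n)
local notation "ℝˢ" => EuclideanSpace ℝ (Fin s)

/-- The transpose `∇g(x)ᵀ` of the Jacobian of `g` at `x`. -/
def gradT (g : ℝⁿ → ℝˢ) (x : ℝⁿ) : ℝˢ →L[ℝ] ℝⁿ :=
  ContinuousLinearMap.adjoint (fderiv ℝ g x)

/-- The Lagrangian `L_μ(x) = f(x) + ∇g(x)ᵀ μ`. -/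
def Lag (f : ℝⁿ → ℝⁿ) (g : ℝⁿ → ℝˢ) (μ : ℝˢ) (x : ℝⁿ) : ℝⁿ :=
  f x + gradT g x μ

/-- The set-valued mapping `F(x, d) = (f(x) + ∇g(x)ᵀ N_D(d), g(x) - d)`. -/
def geMap (f : ℝⁿ → ℝⁿ) (g : ℝⁿ → ℝˢ) (D : Set ℝˢ) (z : WithLp 2 (ℝⁿ × ℝˢ)) :
    Set (WithLp 2 (ℝⁿ × ℝˢ)) :=
  {y | ∃ μ ∈ normalCone D z.snd, y = pair (f z.fst + gradT g z.fst μ) (g z.fst - z.snd)}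

/-- `(x, d)` is non-degenerate with modulus `γ`. -/
def IsNondegenerate (g : ℝⁿ → ℝˢ) (D : Set ℝˢ) (γ : ℝ) (x : ℝⁿ) (d : ℝˢ) : Prop :=
  ∀ μ ∈ Submodule.span ℝ (normalCone D d), γ * ‖μ‖ ≤ ‖gradT g x μ‖

/-- `T(x, d, μ)(p, q) = {(∇L_μ(x)ᵀ p + ∇g(x)ᵀ q, d') | d' + q ∈ D̂*N_D(d, μ)(∇g(x) p)}`. -/
def mapT (f : ℝⁿ → ℝⁿ) (g : ℝⁿ → ℝˢ) (D : Set ℝˢ) (x : ℝⁿ) (d μ : ℝˢ)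
    (p : ℝⁿ) (q : ℝˢ) : Set (WithLp 2 (ℝⁿ × ℝˢ)) :=
  {w | w.fst = ContinuousLinearMap.adjoint (fderiv ℝ (Lag f g μ) x) p + gradT g x q ∧
    w.snd + q ∈ regularCoderivative (normalCone D) d μ (fderiv ℝ g x p)}

/-- `μ` solves the multiplier system `p = f(x) + ∇g(x)ᵀ μ`, `μ ∈ N_D(d)`. -/
def IsMultiplier (f : ℝⁿ → ℝⁿ) (g : ℝⁿ → ℝˢ) (D : Set ℝˢ) (x : ℝⁿ) (d : ℝˢ) (p : ℝⁿ)
    (μ : ℝˢ) : Prop :=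
  μ ∈ normalCone D d ∧ p = Lag f g μ x

/-- At points `((x, d), (p, g(x) - d))` of `gph F` with `(x, d)` non-degenerate, the multiplier
system has exactly one solution. -/
theorem existsUnique_isMultiplier (f : ℝⁿ → ℝⁿ) (g : ℝⁿ → ℝˢ) (D : Set ℝˢ) {γ : ℝ} (hγ : 0 < γ)
    {z y : WithLp 2 (ℝⁿ × ℝˢ)} (hy : y ∈ geMap f g D z)
    (hz : IsNondegenerate g D γ z.fst z.snd) :
    ∃! μ, IsMultiplier f g D z.fst z.snd y.fst μ := by
  obtain ⟨μ, hμ, rfl⟩ := hy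
  refine ⟨μ, ⟨hμ, rfl⟩, ?_⟩
  rintro ν ⟨hν, h⟩
  have h0 : gradT g z.fst (ν - μ) = 0 := by
    have : gradT g z.fst μ = gradT g z.fst ν := by simpa [Lag] using h
    rw [map_sub, this, sub_self]
  have h1 := hz (ν - μ)
    (Submodule.sub_mem _ (Submodule.subset_span hν) (Submodule.subset_span hμ))
  rw [h0, norm_zero] at h1
  have h2 : ‖ν - μ‖ ≤ 0 := nonpos_of_mul_nonpos_right h1 hγ
  exact sub_eq_zero.mp (norm_le_zero_iff.mp h2)

/-- The mapping `𝒟̂*F`, with parameter `γ > 0`. At a graph point `(z, y)`, `z = (x, d)`,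
`y = (p', g(x) - d)`, it is `T(x, d, μ̂)` with the unique multiplier `μ̂ = μ̂(x, d, p')` if `(x, d)` is
non-degenerate with modulus `γ`; otherwise its graph is `{((0, 0), (0, 0))}`. -/
def Dhat (f : ℝⁿ → ℝⁿ) (g : ℝⁿ → ℝˢ) (D : Set ℝˢ) (γ : ℝ)
    (z y : WithLp 2 (ℝⁿ × ℝˢ)) (v : WithLp 2 (ℝⁿ × ℝˢ)) : Set (WithLp 2 (ℝⁿ × ℝˢ)) :=
  {w | (IsNondegenerate g D γ z.fst z.snd ∧
      ∃ μ, IsMultiplier f g D z.fst z.snd y.fst μ ∧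
        w ∈ mapT f g D z.fst z.snd μ v.fst v.snd) ∨
    (¬ IsNondegenerate g D γ z.fst z.snd ∧ v = 0 ∧ w = 0)}

/-- The graph of `𝒟̂*F(z, y)` is a cone at each point `(z, y) ∈ gph F`: it contains the origin and is
closed under multiplication by positive numbers. -/
theorem Dhat_cone (f : ℝⁿ → ℝⁿ) (g : ℝⁿ → ℝˢ) (D : Set ℝˢ) (γ : ℝ)
    {z y : WithLp 2 (ℝⁿ × ℝˢ)} (hy : y ∈ geMap f g D z) :
    (0 : WithLp 2 (ℝⁿ × ℝˢ)) ∈ Dhat f g D γ z y 0 ∧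
    ∀ (t : ℝ) (v w : WithLp 2 (ℝⁿ × ℝˢ)), 0 < t → w ∈ Dhat f g D γ z y v →
      t • w ∈ Dhat f g D γ z y (t • v) := by
  obtain ⟨μ, hμ, rfl⟩ := hy
  constructor
  · by_cases h : IsNondegenerate g D γ z.fst z.snd
    · refine Or.inl ⟨h, μ, ⟨hμ, rfl⟩, by simp, ?_⟩
      intro u _
      have : pair ((0 : WithLp 2 (ℝⁿ × ℝˢ)).snd + (0 : WithLp 2 (ℝⁿ × ℝˢ)).snd)
        (-(fderiv ℝ g z.fst (0 : WithLp 2 (ℝⁿ × ℝˢ)).fst)) = (0 : WithLp 2 (ℝˢ × ℝˢ)) := by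
        simp [pair]
      rw [this, inner_zero_left]
    · exact Or.inr ⟨h, rfl, rfl⟩
  · rintro t v w ht (⟨h, ν, hν, h1, h2⟩ | ⟨h, rfl, rfl⟩)
    · refine Or.inl ⟨h, ν, hν, ?_, ?_⟩
      · simp [h1]
      · intro u hu
        have : pair ((t • w).snd + (t • v).snd) (-(fderiv ℝ g z.fst (t • v).fst)) =
            t • pair (w.snd + v.snd) (-(fderiv ℝ g z.fst v.fst)) := by
          simp [pair, ← WithLp.toLp_smul]
        rw [this, real_inner_smul_left]
        exact mul_nonpos_of_nonneg_of_nonpos ht.le (h2 u hu)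
    · exact Or.inr ⟨h, by simp, by simp⟩

end GE

end SemismoothStar

end

/-! Two facts carry the proof. First, the graph of `N_D` is conical near each of its points `(d₀,
μ₀)`: for nearby `(d, μ)` in the graph, the segments from `(d, μ)` to `(d₀, μ₀)` and to the
reflected point `(2d - d₀, 2μ - μ₀)` stay in the graph. Hence both signs of `(d - d₀, μ - μ₀)` are
tangent and every regular normal is orthogonal to it (`IsConvexPolyhedral.eventually_inner_eq`).
Near a multiplier `μ₀` of `x₀`, the semismoothness* expression therefore reduces to linearization
errors of `g` and of the Lagrangian, both small relative to `‖x - x₀‖` alone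
(`eventually_estimate_of_isMultiplier`).

Second, non-degeneracy with fixed modulus `γ` bounds the multipliers at nearby graph points,
although those of `x₀` itself may be unbounded or non-unique. The local estimate holds near every
`μ₀` in the resulting ball, vacuously if `μ₀` is not a multiplier of `x₀`, and compactness makes it
uniform. Points that are not non-degenerate contribute only zero. -/

open scoped RealInnerProductSpace Topology NNReal
open Filter

namespace SemismoothStar

/-! ### Polyhedral cones, their polars and local conicity -/

section Polyhedral

variable {V : Type*} [NormedAddCommGroup V] [InnerProductSpace ℝ V]

/-- The generators of the intersection of the cone generated by `S` with the half-space
`{x | φ x ≤ 0}` in the double description method. -/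
def doubleDescription (φ : V →ₗ[ℝ] ℝ) (S : Set V) : Set V :=
  {s ∈ S | φ s ≤ 0} ∪ Set.image2 (fun s t => φ s • t - φ t • s) {s ∈ S | 0 < φ s} {t ∈ S | φ t ≤ 0}

theorem doubleDescription_finite (φ : V →ₗ[ℝ] ℝ) {S : Set V} (hS : S.Finite) :
    (doubleDescription φ S).Finite :=
  (hS.subset fun _ h => h.1).union
    (Set.Finite.image2 _ (hS.subset fun _ h => h.1) (hS.subset fun _ h => h.1))

theorem doubleDescription_nonpos (φ : V →ₗ[ℝ] ℝ) {S : Set V} {x : V}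
    (hx : x ∈ doubleDescription φ S) : φ x ≤ 0 := by
  rcases hx with hx | ⟨s, -, t, -, rfl⟩
  · exact hx.2
  · simp [mul_comm]

/-- The expression is linear in `k`. A generator taken from `S` gives a new generator; a combined
generator has `φ = 0` and is only rescaled. -/
theorem smul_sub_smul_mem_span_doubleDescription (φ : V →ₗ[ℝ] ℝ) {S : Set V} {s : V}
    (hs : s ∈ S) (hφ : 0 < φ s) {k : V} (hk : k ∈ Submodule.span ℝ≥0 (doubleDescription φ S)) :
    φ s • k - φ k • s ∈ Submodule.span ℝ≥0 (doubleDescription φ S) := by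
  induction hk using Submodule.span_induction with
  | mem k hk =>
    rcases hk with hk | ⟨s', hs', t, ht, rfl⟩
    · exact Submodule.subset_span (Or.inr ⟨s, ⟨hs, hφ⟩, k, hk, rfl⟩)
    · have h0 : φ (φ s' • t - φ t • s') = 0 := by simp [mul_comm]
      rw [h0, zero_smul, sub_zero]
      exact Submodule.smul_mem _ (⟨φ s, hφ.le⟩ : ℝ≥0)
        (Submodule.subset_span (Or.inr ⟨s', hs', t, ht, rfl⟩))
  | zero => simp
  | add x y _ _ hx hy =>
    have := Submodule.add_mem _ hx hy
    convert this using 1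
    simp only [map_add]
    module
  | smul c x _ hx =>
    have := Submodule.smul_mem _ c hx
    convert this using 1
    simp only [NNReal.smul_def, map_smul, smul_eq_mul]
    module

theorem span_doubleDescription_nonpos (φ : V →ₗ[ℝ] ℝ) {S : Set V} {k : V}
    (hk : k ∈ Submodule.span ℝ≥0 (doubleDescription φ S)) : φ k ≤ 0 := by
  induction hk using Submodule.span_induction with
  | mem k hk => exact doubleDescription_nonpos φ hk
  | zero => simp
  | add x y _ _ hx hy => rw [map_add]; exact add_nonpos hx hy
  | smul c x _ hx =>
    rw [NNReal.smul_def, map_smul, smul_eq_mul]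
    exact mul_nonpos_of_nonneg_of_nonpos c.2 hx

theorem mem_span_doubleDescription (φ : V →ₗ[ℝ] ℝ) {S : Set V} {x : V}
    (hx : x ∈ Submodule.span ℝ≥0 S) (hφ : φ x ≤ 0) :
    x ∈ Submodule.span ℝ≥0 (doubleDescription φ S) := by
  -- The summand `k` makes induction over sums possible: terms with `φ > 0` need a partner to
  -- compensate them.
  suffices h : ∀ k ∈ Submodule.span ℝ≥0 (doubleDescription φ S), φ (k + x) ≤ 0 →
      k + x ∈ Submodule.span ℝ≥0 (doubleDescription φ S) by
    simpa using h 0 (Submodule.zero_mem _) (by simpa using hφ)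
  clear hφ
  induction hx using Submodule.span_induction with
  | mem s hs =>
    intro k hk hks
    by_cases hφ : φ s ≤ 0
    · exact Submodule.add_mem _ hk (Submodule.subset_span (Or.inl ⟨hs, hφ⟩))
    · push Not at hφ
      rw [map_add] at hks
      have hφk : φ k < 0 := by linarith
      have h1 := smul_sub_smul_mem_span_doubleDescription φ hs hφ hk
      have h2 := Submodule.smul_mem _
        (⟨1 + φ s / φ k, by
          have : -1 ≤ φ s / φ k := by rw [le_div_iff_of_neg hφk]; linarith
          linarith⟩ : ℝ≥0) hk
      have h3 := Submodule.smul_mem _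
        (⟨-(φ k)⁻¹, by simpa using hφk.le⟩ : ℝ≥0) h1
      -- Both coefficients are nonnegative because `φ k ≤ -φ s < 0`.
      convert Submodule.add_mem _ h2 h3 using 1
      change k + s = (1 + φ s / φ k) • k + (-(φ k)⁻¹) • (φ s • k - φ k • s)
      match_scalars
      · field_simp
        ring
      · rw [mul_one, mul_neg, neg_mul, neg_neg, inv_mul_cancel₀ hφk.ne]
  | zero => intro k hk _; simpa using hk
  | add x y _ _ hx hy =>
    intro k hk hφ
    by_cases h : φ (k + x) ≤ 0
    · rw [← add_assoc] at hφ ⊢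
      exact hy _ (hx k hk h) hφ
    -- Here `φ x > 0`, so `φ y < 0`, and absorbing `y` before `x` keeps the partial sum admissible.
    · have hkn := span_doubleDescription_nonpos φ hk
      rw [add_comm x y, ← add_assoc] at hφ ⊢
      refine hx _ (hy k hk ?_) hφ
      simp only [map_add] at *
      linarith
  | smul c x _ hx =>
    intro k hk hφ
    rcases eq_or_ne c 0 with rfl | hc
    · simpa using hk
    · have hc' : (0 : ℝ) < c := by positivity
      have h1 := hx (c⁻¹ • k) (Submodule.smul_mem _ _ hk) (by
        have h2 := mul_nonpos_of_nonneg_of_nonpos (inv_nonneg.2 hc'.le) hφ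
        simp only [NNReal.smul_def, map_add, map_smul, smul_eq_mul, NNReal.coe_inv] at h2 ⊢
        rwa [mul_add, inv_mul_cancel_left₀ hc'.ne'] at h2)
      have := Submodule.smul_mem _ c h1
      rwa [smul_add, smul_inv_smul₀ hc] at this

theorem exists_finite_span_nnreal_eq_top [FiniteDimensional ℝ V] :
    ∃ S : Set V, S.Finite ∧ ∀ x, x ∈ Submodule.span ℝ≥0 S := by
  let b := Module.finBasis ℝ V
  refine ⟨Set.range b ∪ Set.range (fun i => -b i),
    (Set.finite_range _).union (Set.finite_range _), fun x => ?_⟩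
  rw [← b.sum_repr x]
  refine Submodule.sum_mem _ fun i _ => ?_
  rcases le_total 0 (b.repr x i) with h | h
  · exact Submodule.smul_mem _ (⟨b.repr x i, h⟩ : ℝ≥0)
      (Submodule.subset_span (Or.inl ⟨i, rfl⟩))
  · rw [← neg_smul_neg]
    exact Submodule.smul_mem _ (⟨-b.repr x i, neg_nonneg.2 h⟩ : ℝ≥0)
      (Submodule.subset_span (Or.inr ⟨i, rfl⟩))

/-- A cone that is an intersection of finitely many half-spaces is finitely generated. -/
theorem exists_finite_generators [FiniteDimensional ℝ V] {ι : Type*} (a : ι → V)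
    {I : Set ι} (hI : I.Finite) :
    ∃ S : Set V, S.Finite ∧ (∀ e ∈ S, ∀ i ∈ I, ⟪a i, e⟫ ≤ 0) ∧
      ∀ x, (∀ i ∈ I, ⟪a i, x⟫ ≤ 0) → x ∈ Submodule.span ℝ≥0 S := by
  induction I, hI using Set.Finite.induction_on with
  | empty =>
    obtain ⟨S, hS, h⟩ := exists_finite_span_nnreal_eq_top (V := V)
    exact ⟨S, hS, by simp, fun x _ => h x⟩
  | @insert i I _ _ ih =>
    obtain ⟨S, hS, h1, h2⟩ := ih
    let φ : V →ₗ[ℝ] ℝ := (innerₛₗ ℝ (a i))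
    refine ⟨doubleDescription φ S, doubleDescription_finite φ hS, fun e he j hj => ?_,
      fun x hx => ?_⟩
    · rcases hj with rfl | hj
      · exact doubleDescription_nonpos φ he
      · rcases he with he | ⟨s, hs, t, ht, rfl⟩
        · exact h1 e he.1 j hj
        · have hs1 := h1 s hs.1 j hj
          have ht1 := h1 t ht.1 j hj
          simp only [inner_sub_right, inner_smul_right]
          have := mul_nonpos_of_nonneg_of_nonpos hs.2.le ht1
          have := mul_nonneg_of_nonpos_of_nonpos ht.2 hs1
          linarith
    · exact mem_span_doubleDescription φ (h2 x fun j hj => hx j (Or.inr hj)) (hx i (Or.inl rfl))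

/-- The polar of the cone `{e | ⟪a i, e⟫ ≤ 0 for all i ∈ I}`. -/
def polarCone {ι : Type*} (a : ι → V) (I : Set ι) : Set V :=
  {μ | ∀ e, (∀ i ∈ I, ⟪a i, e⟫ ≤ 0) → ⟪μ, e⟫ ≤ 0}

/-- The polar of a polyhedral cone is polyhedral. -/
theorem exists_finite_polarCone_eq [FiniteDimensional ℝ V] {ι : Type*} (a : ι → V)
    {I : Set ι} (hI : I.Finite) :
    ∃ S : Set V, S.Finite ∧ polarCone a I = {μ | ∀ e ∈ S, ⟪e, μ⟫ ≤ 0} := by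
  obtain ⟨S, hS, h1, h2⟩ := exists_finite_generators a hI
  refine ⟨S, hS, Set.Subset.antisymm (fun μ hμ e he => ?_) fun μ hμ e he => ?_⟩
  · rw [real_inner_comm]
    exact hμ e (h1 e he)
  · have := h2 e he
    clear he
    induction this using Submodule.span_induction with
    | mem e he => rw [real_inner_comm]; exact hμ e he
    | zero => simp
    | add x y _ _ hx hy => rw [inner_add_right]; exact add_nonpos hx hy
    | smul c x _ hx =>
      rw [NNReal.smul_def, real_inner_smul_right]
      exact mul_nonpos_of_nonneg_of_nonpos c.2 hx

/-- Near one of its points, a polyhedral set is conical. -/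
theorem eventually_two_smul_sub_mem {ι : Type*} {I : Set ι} (hI : I.Finite) (a : ι → V)
    (b : ι → ℝ) {x₀ : V} (hx₀ : ∀ i ∈ I, ⟪a i, x₀⟫ ≤ b i) :
    ∀ᶠ x in 𝓝 x₀, (∀ i ∈ I, ⟪a i, x⟫ ≤ b i) → ∀ i ∈ I, ⟪a i, (2 : ℝ) • x - x₀⟫ ≤ b i := by
  have key : ∀ i ∈ I, ∀ᶠ x in 𝓝 x₀, ⟪a i, x⟫ ≤ b i → ⟪a i, (2 : ℝ) • x - x₀⟫ ≤ b i := by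
    intro i hi
    rcases (hx₀ i hi).eq_or_lt with h | h
    · refine Eventually.of_forall fun x hx => ?_
      rw [inner_sub_right, real_inner_smul_right]
      linarith
    · have hc : Continuous fun x => ⟪a i, (2 : ℝ) • x - x₀⟫ := by fun_prop
      have h1 : ⟪a i, (2 : ℝ) • x₀ - x₀⟫ < b i := by
        rwa [two_smul, add_sub_cancel_right]
      filter_upwards [hc.continuousAt.eventually_lt continuousAt_const h1] with x hx _
      exact hx.le
  filter_upwards [(eventually_all_finite hI).2 key] with x hx h i hi
  exact hx i hi (h i hi)

/-- The polar is again polyhedral, so local conicity applies at its points; outside it, closedness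
excludes nearby `μ`. -/
theorem eventually_mem_polarCone [FiniteDimensional ℝ V] {ι : Type*} (a : ι → V)
    {I : Set ι} (hI : I.Finite) (μ₀ : V) :
    ∀ᶠ μ in 𝓝 μ₀, μ ∈ polarCone a I →
      μ₀ ∈ polarCone a I ∧ (2 : ℝ) • μ - μ₀ ∈ polarCone a I := by
  obtain ⟨S, hS, h⟩ := exists_finite_polarCone_eq a hI
  by_cases h0 : μ₀ ∈ polarCone a I
  · rw [h] at h0 ⊢
    filter_upwards [eventually_two_smul_sub_mem hS id 0 h0] with μ hμ h1
    exact ⟨h0, hμ h1⟩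
  · have hc : IsClosed (polarCone a I) := by
      simp only [polarCone, Set.ofPred_forall]
      exact isClosed_iInter fun e => isClosed_iInter fun _ =>
        isClosed_le (by fun_prop) continuous_const
    filter_upwards [hc.isOpen_compl.mem_nhds h0] with μ hμ h1
    exact absurd h1 hμ

theorem normalCone_eq_polarCone {ι : Type*} [Finite ι] (a : ι → V) (b : ι → ℝ) {d : V}
    (hd : ∀ i, ⟪a i, d⟫ ≤ b i) :
    normalCone {d | ∀ i, ⟪a i, d⟫ ≤ b i} d = polarCone a {i | ⟪a i, d⟫ = b i} := by
  refine Set.Subset.antisymm (fun μ hμ e he => ?_) fun μ hμ => ⟨hd, fun e he => hμ _ ?_⟩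
  -- A small step along `e` stays feasible: active constraints do not increase and inactive ones
  -- have slack.
  · have key : ∀ i, ∀ᶠ t in 𝓝[>] (0 : ℝ), ⟪a i, d + t • e⟫ ≤ b i := by
      intro i
      rcases (hd i).eq_or_lt with h | h
      · filter_upwards [self_mem_nhdsWithin] with t ht
        rw [inner_add_right, real_inner_smul_right, h]
        have := mul_nonpos_of_nonneg_of_nonpos (le_of_lt ht) (he i h)
        linarith
      · have hc : Continuous fun t : ℝ => ⟪a i, d + t • e⟫ := by fun_prop
        have h1 : ⟪a i, d + (0 : ℝ) • e⟫ < b i := by simpa using h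
        filter_upwards [(hc.continuousAt.eventually_lt continuousAt_const h1).filter_mono
          nhdsWithin_le_nhds] with t ht
        exact ht.le
    obtain ⟨t, ht, ht0⟩ := ((eventually_all.2 key).and self_mem_nhdsWithin).exists
    have h1 := hμ.2 _ ht
    rw [add_sub_cancel_left, real_inner_smul_right] at h1
    exact nonpos_of_mul_nonpos_right h1 ht0
  · intro i hi
    rw [inner_sub_right, hi]
    linarith [he i]

end Polyhedral

/-! ### The graph of the normal cone mapping -/

section NormalConeGraph

variable {V : Type*} [NormedAddCommGroup V] [InnerProductSpace ℝ V]

theorem IsConvexPolyhedral.convex {D : Set V} (hD : IsConvexPolyhedral D) : Convex ℝ D := by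
  obtain ⟨m, a, b, rfl⟩ := hD
  simp only [Set.ofPred_forall]
  exact convex_iInter fun i => convex_halfSpace_le (innerₛₗ ℝ (a i)).isLinear (b i)

theorem IsConvexPolyhedral.isClosed {D : Set V} (hD : IsConvexPolyhedral D) : IsClosed D := by
  obtain ⟨m, a, b, rfl⟩ := hD
  simp only [Set.ofPred_forall]
  exact isClosed_iInter fun i => isClosed_le (by fun_prop) continuous_const

theorem isClosed_normalCone_graph {D : Set V} (hD : IsClosed D) :
    IsClosed {w : V × V | w.2 ∈ normalCone D w.1} := by
  have : {w : V × V | w.2 ∈ normalCone D w.1} =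
      (Prod.fst ⁻¹' D) ∩ ⋂ e ∈ D, {w : V × V | ⟪w.2, e - w.1⟫ ≤ 0} := by
    ext w
    simp [normalCone]
  rw [this]
  exact (hD.preimage continuous_fst).inter (isClosed_biInter fun e _ =>
    isClosed_le (by fun_prop) continuous_const)

theorem mem_normalCone_of_inner_eq_zero {D : Set V} {d d' μ : V} (hμ : μ ∈ normalCone D d)
    (hd' : d' ∈ D) (h : ⟪μ, d' - d⟫ = 0) : μ ∈ normalCone D d' := by
  refine ⟨hd', fun e he => ?_⟩
  have := hμ.2 e he
  rw [inner_sub_right] at *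
  linarith

theorem segment_subset_gph_normalCone {D : Set V} (hD : Convex ℝ D) {d d' μ μ' : V}
    (hμ : μ ∈ normalCone D d) (hμ' : μ' ∈ normalCone D d') (h : ⟪μ - μ', d - d'⟫ = 0) :
    segment ℝ (pair d μ) (pair d' μ') ⊆ gph (normalCone D) := by
  rintro _ ⟨α, β, hα, hβ, hαβ, rfl⟩
  refine ⟨hD hμ.1 hμ'.1 hα hβ hαβ, fun e he => ?_⟩
  have h1 := hμ.2 e he
  have h2 := hμ'.2 e he
  have hα' : α = 1 - β := by linarith
  subst hα'
  -- The only cross term is a multiple of `⟪μ - μ', d - d'⟫`, which vanishes.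
  have h3 : ⟪(1 - β) • μ + β • μ', e - ((1 - β) • d + β • d')⟫ =
      (1 - β) * ⟪μ, e - d⟫ + β * ⟪μ', e - d'⟫ + β * (1 - β) * ⟪μ - μ', d - d'⟫ := by
    simp only [inner_sub_left, inner_sub_right, inner_add_left, inner_add_right,
      real_inner_smul_left, real_inner_smul_right]
    ring
  change ⟪(1 - β) • μ + β • μ', e - ((1 - β) • d + β • d')⟫ ≤ 0
  rw [h3, h]
  have := mul_nonpos_of_nonneg_of_nonpos hα h1
  have := mul_nonpos_of_nonneg_of_nonpos hβ h2
  linarith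

/-- Near a point of its graph, the normal cone mapping of a polyhedral set is conical. -/
theorem IsConvexPolyhedral.eventually_mem_normalCone [FiniteDimensional ℝ V] {D : Set V}
    (hD : IsConvexPolyhedral D) {d₀ : V} (μ₀ : V) (hd₀ : d₀ ∈ D) :
    ∀ᶠ w : V × V in 𝓝 (d₀, μ₀), w.2 ∈ normalCone D w.1 → ⟪w.2 - μ₀, w.1 - d₀⟫ = 0 ∧
      (2 : ℝ) • w.2 - μ₀ ∈ normalCone D ((2 : ℝ) • w.1 - d₀) := by
  obtain ⟨m, a, b, rfl⟩ := hD
  have h1 := eventually_two_smul_sub_mem (Set.finite_univ (α := Fin m)) a b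
    (fun i _ => hd₀ i)
  -- The active set varies with `d`, but only finitely many index sets are possible.
  have h2 : ∀ᶠ μ in 𝓝 μ₀, ∀ I : Set (Fin m), μ ∈ polarCone a I →
      μ₀ ∈ polarCone a I ∧ (2 : ℝ) • μ - μ₀ ∈ polarCone a I :=
    eventually_all.2 fun I => eventually_mem_polarCone a I.toFinite μ₀
  filter_upwards [h1.prod_nhds h2] with ⟨d, μ⟩ ⟨h1, h2⟩ hμ
  simp only at h1 h2 hμ ⊢
  have hd : ∀ i, ⟪a i, d⟫ ≤ b i := hμ.1
  have hd2 : ∀ i, ⟪a i, (2 : ℝ) • d - d₀⟫ ≤ b i := fun i =>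
    h1 (fun i _ => hd i) i trivial
  have hN := normalCone_eq_polarCone a b hd
  have h3 := h2 {i | ⟪a i, d⟫ = b i} (hN ▸ hμ)
  rw [← hN] at h3
  -- `d` is the midpoint of `d₀` and `2d - d₀`, both in `D`, so the normal inequality holds with
  -- both signs.
  have key : ∀ ν ∈ normalCone {d | ∀ i, ⟪a i, d⟫ ≤ b i} d, ⟪ν, d - d₀⟫ = 0 := by
    intro ν hν
    have e1 := hν.2 _ hd2
    have e2 := hν.2 _ hd₀
    have : (2 : ℝ) • d - d₀ - d = d - d₀ := by module
    rw [this] at e1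
    rw [← neg_sub, inner_neg_right] at e2
    linarith
  refine ⟨by rw [inner_sub_left, key μ hμ, key μ₀ h3.1, sub_zero],
    mem_normalCone_of_inner_eq_zero h3.2 hd2 ?_⟩
  have : (2 : ℝ) • d - d₀ - d = d - d₀ := by module
  rw [this, key _ h3.2]

/-- The normal cone mapping of a polyhedral set satisfies the semismoothness* estimate with zero
error near each point of its graph. -/
theorem IsConvexPolyhedral.eventually_inner_eq [FiniteDimensional ℝ V] {D : Set V}
    (hD : IsConvexPolyhedral D) {d₀ μ₀ : V} (hμ₀ : μ₀ ∈ normalCone D d₀) :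
    ∀ᶠ w : V × V in 𝓝 (d₀, μ₀), w.2 ∈ normalCone D w.1 →
      ∀ v u, u ∈ regularCoderivative (normalCone D) w.1 w.2 v →
        ⟪u, w.1 - d₀⟫ = ⟪v, w.2 - μ₀⟫ := by
  filter_upwards [hD.eventually_mem_normalCone μ₀ hμ₀.1] with ⟨d, μ⟩ h hμ v u hu
  obtain ⟨h0, h2⟩ := h hμ
  simp only at h0 h2 hμ hu ⊢
  have s1 := segment_subset_gph_normalCone hD.convex hμ hμ₀ h0
  have s2 := segment_subset_gph_normalCone hD.convex hμ h2 (by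
    have e1 : μ - ((2 : ℝ) • μ - μ₀) = -(μ - μ₀) := by module
    have e2 : d - ((2 : ℝ) • d - d₀) = -(d - d₀) := by module
    rw [e1, e2, inner_neg_neg, h0])
  have i1 := hu _ (sub_mem_posTangentConeAt_of_segment_subset s1)
  have i2 := hu _ (sub_mem_posTangentConeAt_of_segment_subset s2)
  have e1 : pair d₀ μ₀ - pair d μ = pair (-(d - d₀)) (-(μ - μ₀)) := by
    simp [pair, ← WithLp.toLp_sub]
  have e2 : pair ((2 : ℝ) • d - d₀) ((2 : ℝ) • μ - μ₀) - pair d μ = pair (d - d₀) (μ - μ₀) := by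
    simp only [pair, ← WithLp.toLp_sub, Prod.mk_sub_mk]
    congr 2 <;> module
  rw [e1, WithLp.prod_inner_apply] at i1
  rw [e2, WithLp.prod_inner_apply] at i2
  simp only [inner_neg_left, inner_neg_right] at i1 i2
  linarith

end NormalConeGraph

/-! ### Linearization with the derivative at the moving point -/

section Linearization

variable {E F : Type*} [NormedAddCommGroup E] [NormedSpace ℝ E] [NormedAddCommGroup F]
  [NormedSpace ℝ F]

theorem eventually_norm_linearization_le {h : E → F} (hh : ContDiff ℝ 1 h) (x₀ : E) {η : ℝ}
    (hη : 0 < η) :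
    ∀ᶠ x in 𝓝 x₀, ‖h x₀ - h x + fderiv ℝ h x (x - x₀)‖ ≤ η * ‖x - x₀‖ := by
  have h1 := ((hh.differentiable one_ne_zero) x₀).hasFDerivAt.isLittleO.def (half_pos hη)
  have h2 := Metric.continuousAt_iff'.1
    ((hh.continuous_fderiv one_ne_zero).continuousAt (x := x₀)) _ (half_pos hη)
  filter_upwards [h1, h2] with x h1 h2
  rw [dist_eq_norm] at h2
  have h3 : h x₀ - h x + fderiv ℝ h x (x - x₀) =
      (fderiv ℝ h x - fderiv ℝ h x₀) (x - x₀) - (h x - h x₀ - fderiv ℝ h x₀ (x - x₀)) := by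
    rw [sub_apply]
    abel
  rw [h3]
  refine (norm_sub_le _ _).trans ?_
  have h4 := (fderiv ℝ h x - fderiv ℝ h x₀).le_of_opNorm_le h2.le (x - x₀)
  linarith

end Linearization

/-! ### The estimate for the generalized equation -/

section GE

variable {n s : ℕ}

local notation "ℝⁿ" => EuclideanSpace ℝ (Fin n)
local notation "ℝˢ" => EuclideanSpace ℝ (Fin s)

theorem contDiff_gradT {g : ℝⁿ → ℝˢ} (hg : ContDiff ℝ 2 g) : ContDiff ℝ 1 (gradT g) := by
  have h : IsBoundedLinearMap ℝ (fun A : ℝⁿ →L[ℝ] ℝˢ => ContinuousLinearMap.adjoint A) :=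
    { map_add := fun A B => map_add _ A B
      map_smul := fun c A => by simp
      bound := ⟨1, one_pos, fun A => by simp⟩ }
  exact h.contDiff.comp (hg.fderiv_right (by norm_num))

theorem fderiv_Lag_apply {f : ℝⁿ → ℝⁿ} {g : ℝⁿ → ℝˢ} (hf : ContDiff ℝ 1 f)
    (hg : ContDiff ℝ 2 g) (μ : ℝˢ) (x u : ℝⁿ) :
    fderiv ℝ (Lag f g μ) x u = fderiv ℝ f x u + fderiv ℝ (gradT g) x u μ := by
  have h1 := (hf.differentiable one_ne_zero x).hasFDerivAt
  have h2 := ((contDiff_gradT hg).differentiable one_ne_zero x).hasFDerivAt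
  have h3 := h1.add (h2.clm_apply (hasFDerivAt_const μ x))
  have h4 : HasFDerivAt (Lag f g μ) _ x := h3
  rw [h4.fderiv]
  simp

/-- Near a multiplier `μ₀` at `x₀`, the Lagrangian is linearized up to a small error. -/
theorem eventually_norm_Lag_le {f : ℝⁿ → ℝⁿ} {g : ℝⁿ → ℝˢ} (hf : ContDiff ℝ 1 f)
    (hg : ContDiff ℝ 2 g) {x₀ : ℝⁿ} {μ₀ : ℝˢ} (h0 : Lag f g μ₀ x₀ = 0) {ε : ℝ} (hε : 0 < ε) :
    ∀ᶠ w : ℝⁿ × ℝˢ in 𝓝 (x₀, μ₀),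
      ‖fderiv ℝ (Lag f g w.2) w.1 (w.1 - x₀) - Lag f g w.2 w.1 + gradT g w.1 (w.2 - μ₀)‖ ≤
        ε * ‖w.1 - x₀‖ := by
  have hG := contDiff_gradT hg
  set M := ‖μ₀‖ + 1 with hM
  have hM0 : 0 < M := by positivity
  obtain ⟨K, hK, hKb⟩ := ((hG.differentiable one_ne_zero) x₀).hasFDerivAt.isBigO_sub.exists_pos
  have e1 := eventually_norm_linearization_le hf x₀ (η := ε / 3) (by positivity)
  have e2 := eventually_norm_linearization_le hG x₀ (η := ε / (3 * M)) (by positivity)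
  have e3 : ∀ᶠ μ in 𝓝 μ₀, ‖μ - μ₀‖ < min 1 (ε / (3 * K)) := by
    filter_upwards [Metric.ball_mem_nhds μ₀ (lt_min one_pos (by positivity : 0 < ε / (3 * K)))]
      with μ hμ
    rwa [← dist_eq_norm]
  filter_upwards [((e1.and e2).and hKb.bound).prod_nhds e3]
    with ⟨x, μ⟩ ⟨⟨⟨e1, e2⟩, eK⟩, e3⟩
  simp only at e1 e2 e3 eK ⊢
  obtain ⟨e3, e4⟩ := lt_min_iff.1 e3
  have hμ : ‖μ‖ ≤ M := by
    have := norm_add_le μ₀ (μ - μ₀)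
    rw [add_sub_cancel] at this
    linarith
  -- Since `‖μ - μ₀‖` is not controlled by `‖x - x₀‖`, it appears only multiplied by a difference of
  -- `gradT g`, which is at most `K * ‖x - x₀‖`.
  have key : fderiv ℝ (Lag f g μ) x (x - x₀) - Lag f g μ x + gradT g x (μ - μ₀) =
      (f x₀ - f x + fderiv ℝ f x (x - x₀)) +
      (gradT g x₀ - gradT g x + fderiv ℝ (gradT g) x (x - x₀)) μ +
      (gradT g x - gradT g x₀) (μ - μ₀) := by
    have h0' : f x₀ = - gradT g x₀ μ₀ := eq_neg_of_add_eq_zero_left h0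
    rw [fderiv_Lag_apply hf hg, Lag, h0']
    simp only [add_apply, sub_apply, map_sub]
    abel
  rw [key]
  have b2 := ContinuousLinearMap.le_of_opNorm_le_of_le _ e2 hμ
  have b3 := ContinuousLinearMap.le_of_opNorm_le_of_le _ eK e4.le
  have c2 : ε / (3 * M) * ‖x - x₀‖ * M = ε / 3 * ‖x - x₀‖ := by field_simp
  have c3 : K * ‖x - x₀‖ * (ε / (3 * K)) = ε / 3 * ‖x - x₀‖ := by field_simp
  refine (norm_add₃_le).trans ?_
  linarith

theorem eventually_estimate_of_isMultiplier {f : ℝⁿ → ℝⁿ} {g : ℝⁿ → ℝˢ} {D : Set ℝˢ}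
    (hf : ContDiff ℝ 1 f) (hg : ContDiff ℝ 2 g) (hD : IsConvexPolyhedral D) {x₀ : ℝⁿ} {μ₀ : ℝˢ}
    (h0 : IsMultiplier f g D x₀ (g x₀) 0 μ₀) {ε : ℝ} (hε : 0 < ε) :
    ∀ᶠ w : (ℝⁿ × ℝˢ) × ℝˢ in 𝓝 ((x₀, g x₀), μ₀), w.2 ∈ normalCone D w.1.2 →
      ∀ (p : ℝⁿ) (q : ℝˢ), ∀ u ∈ mapT f g D w.1.1 w.1.2 w.2 p q,
        |⟪u, pair (w.1.1 - x₀) (w.1.2 - g x₀)⟫ -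
          ⟪pair p q, pair (Lag f g w.2 w.1.1) (g w.1.1 - w.1.2)⟫| ≤
          ε * ‖w.1.1 - x₀‖ * ‖pair p q‖ := by
  have t1 : Tendsto (fun w : (ℝⁿ × ℝˢ) × ℝˢ => (w.1.1, w.2)) (𝓝 ((x₀, g x₀), μ₀))
      (𝓝 (x₀, μ₀)) := Continuous.tendsto (by fun_prop) _
  have t2 : Tendsto (fun w : (ℝⁿ × ℝˢ) × ℝˢ => (w.1.2, w.2)) (𝓝 ((x₀, g x₀), μ₀))
      (𝓝 (g x₀, μ₀)) := Continuous.tendsto (by fun_prop) _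
  have t3 : Tendsto (fun w : (ℝⁿ × ℝˢ) × ℝˢ => w.1.1) (𝓝 ((x₀, g x₀), μ₀)) (𝓝 x₀) :=
    Continuous.tendsto (by fun_prop) _
  have e1 := t1.eventually (eventually_norm_Lag_le hf hg h0.2.symm (half_pos hε))
  have e2 := t2.eventually (hD.eventually_inner_eq h0.1)
  have e3 := t3.eventually
    (eventually_norm_linearization_le (hg.of_le (by norm_num)) x₀ (half_pos hε))
  filter_upwards [e1, e2, e3] with ⟨⟨x, d⟩, μ⟩ e1 e2 e3 hμ p q u ⟨hu1, hu2⟩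
  simp only at e1 e2 e3 hμ hu1 hu2 ⊢
  have i1 := e2 hμ _ _ hu2
  set A := fderiv ℝ (Lag f g μ) x (x - x₀) - Lag f g μ x + gradT g x (μ - μ₀) with hA
  set B := g x₀ - g x + fderiv ℝ g x (x - x₀) with hB
  -- By the adjoint identities, all else cancels through the coderivative equality `i1`.
  have key : ⟪u, pair (x - x₀) (d - g x₀)⟫ - ⟪pair p q, pair (Lag f g μ x) (g x - d)⟫ =
      ⟪p, A⟫ + ⟪q, B⟫ := by
    rw [WithLp.prod_inner_apply, WithLp.prod_inner_apply]
    change ⟪u.fst, x - x₀⟫ + ⟪u.snd, d - g x₀⟫ - (⟪p, Lag f g μ x⟫ + ⟪q, g x - d⟫) = _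
    have i2 : ⟪p, gradT g x (μ - μ₀)⟫ = ⟪fderiv ℝ g x p, μ - μ₀⟫ :=
      ContinuousLinearMap.adjoint_inner_right _ _ _
    have i3 : ⟪gradT g x q, x - x₀⟫ = ⟪q, fderiv ℝ g x (x - x₀)⟫ :=
      ContinuousLinearMap.adjoint_inner_left _ _ _
    have i4 : ⟪q, d - g x₀⟫ = ⟪q, g x - g x₀⟫ - ⟪q, g x - d⟫ := by
      rw [← inner_sub_right]
      congr 1
      abel
    rw [hu1, hA, hB, inner_add_left, i3, ContinuousLinearMap.adjoint_inner_left]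
    rw [inner_add_left] at i1
    have i5 : ⟪q, g x₀ - g x + fderiv ℝ g x (x - x₀)⟫ =
        -⟪q, g x - g x₀⟫ + ⟪q, fderiv ℝ g x (x - x₀)⟫ := by
      rw [inner_add_right, ← inner_neg_right, neg_sub]
    rw [i5, inner_add_right, inner_sub_right p, i2]
    linarith
  have hp : ‖p‖ ≤ ‖pair p q‖ := WithLp.norm_fst_le _ (pair p q)
  have hq : ‖q‖ ≤ ‖pair p q‖ := WithLp.norm_snd_le _ (pair p q)
  rw [key]
  have b1 : |⟪p, A⟫| ≤ ‖pair p q‖ * (ε / 2 * ‖x - x₀‖) :=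
    (abs_real_inner_le_norm p A).trans (by gcongr)
  have b2 : |⟪q, B⟫| ≤ ‖pair p q‖ * (ε / 2 * ‖x - x₀‖) :=
    (abs_real_inner_le_norm q B).trans (by gcongr)
  have := abs_add_le ⟪p, A⟫ ⟪q, B⟫
  linarith

/-- The semismoothness* estimate for multipliers near an arbitrary `μ₀`. -/
theorem eventually_estimate {f : ℝⁿ → ℝⁿ} {g : ℝⁿ → ℝˢ} {D : Set ℝˢ}
    (hf : ContDiff ℝ 1 f) (hg : ContDiff ℝ 2 g) (hD : IsConvexPolyhedral D) (x₀ : ℝⁿ) (μ₀ : ℝˢ)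
    {ε : ℝ} (hε : 0 < ε) :
    ∀ᶠ w : (ℝⁿ × ℝˢ × ℝⁿ) × ℝˢ in 𝓝 ((x₀, g x₀, 0), μ₀),
      IsMultiplier f g D w.1.1 w.1.2.1 w.1.2.2 w.2 →
      ∀ (p : ℝⁿ) (q : ℝˢ), ∀ u ∈ mapT f g D w.1.1 w.1.2.1 w.2 p q,
        |⟪u, pair (w.1.1 - x₀) (w.1.2.1 - g x₀)⟫ -
          ⟪pair p q, pair w.1.2.2 (g w.1.1 - w.1.2.1)⟫| ≤
          ε * ‖w.1.1 - x₀‖ * ‖pair p q‖ := by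
  by_cases h0 : IsMultiplier f g D x₀ (g x₀) 0 μ₀
  · have t : Tendsto (fun w : (ℝⁿ × ℝˢ × ℝⁿ) × ℝˢ => ((w.1.1, w.1.2.1), w.2))
        (𝓝 ((x₀, g x₀, 0), μ₀)) (𝓝 ((x₀, g x₀), μ₀)) := Continuous.tendsto (by fun_prop) _
    filter_upwards [t.eventually (eventually_estimate_of_isMultiplier hf hg hD h0 hε)]
      with w h hw
    rw [hw.2]
    exact h hw.1
  -- Multipliers form a closed relation, so none exist near a non-multiplier `μ₀`.
  · have hc : IsClosed {w : (ℝⁿ × ℝˢ × ℝⁿ) × ℝˢ |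
        IsMultiplier f g D w.1.1 w.1.2.1 w.1.2.2 w.2} := by
      have c1 := hf.continuous
      have c2 := (contDiff_gradT hg).continuous
      have : Continuous fun w : (ℝⁿ × ℝˢ × ℝⁿ) × ℝˢ => Lag f g w.2 w.1.1 := by
        unfold Lag
        fun_prop
      exact ((isClosed_normalCone_graph hD.isClosed).preimage
        (by fun_prop : Continuous fun w : (ℝⁿ × ℝˢ × ℝⁿ) × ℝˢ => (w.1.2.1, w.2))).inter
        (isClosed_eq (by fun_prop) this)
    filter_upwards [hc.isOpen_compl.mem_nhds h0] with w hw h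
    exact absurd h hw

end GE

end SemismoothStar

open SemismoothStar Filter Topology in
theorem mainTheorem5 (n s : ℕ)
    (f : EuclideanSpace ℝ (Fin n) → EuclideanSpace ℝ (Fin n)) (hf : ContDiff ℝ 1 f)
    (g : EuclideanSpace ℝ (Fin n) → EuclideanSpace ℝ (Fin s)) (hg : ContDiff ℝ 2 g)
    (D : Set (EuclideanSpace ℝ (Fin s))) (hD : SemismoothStar.IsConvexPolyhedral D)
    (γ : ℝ) (hγ : 0 < γ)
    (x₀ : EuclideanSpace ℝ (Fin n)) (hx₀ : 0 ∈ SemismoothStar.geMap f g D (SemismoothStar.pair x₀ (g x₀))) :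
    SemismoothStar.IsSemismoothStarWrt (SemismoothStar.geMap f g D) (SemismoothStar.Dhat f g D γ)
      (SemismoothStar.pair x₀ (g x₀)) 0 := by
  intro ε hε
  -- From `γ‖μ‖ ≤ ‖∇g(x)ᵀμ‖ = ‖p - f(x)‖`, with `‖p‖ ≤ 1` and `‖f(x)‖ < ‖f(x₀)‖ + 1` near `x₀`.
  set R := (1 + (‖f x₀‖ + 1)) / γ with hR
  have h1 := IsCompact.eventually_forall_of_forall_eventually (P := fun
      (t : EuclideanSpace ℝ (Fin n) × EuclideanSpace ℝ (Fin s) × EuclideanSpace ℝ (Fin n)) μ =>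
      IsMultiplier f g D t.1 t.2.1 t.2.2 μ → ∀ p q, ∀ u ∈ mapT f g D t.1 t.2.1 μ p q,
        |⟪u, pair (t.1 - x₀) (t.2.1 - g x₀)⟫ - ⟪pair p q, pair t.2.2 (g t.1 - t.2.1)⟫| ≤
          ε * ‖t.1 - x₀‖ * ‖pair p q‖)
    (isCompact_closedBall (0 : EuclideanSpace ℝ (Fin s)) R)
    fun μ₀ _ => eventually_estimate hf hg hD x₀ μ₀ hε
  have hfc : ∀ᶠ x in 𝓝 x₀, ‖f x‖ < ‖f x₀‖ + 1 :=
    hf.continuous.norm.continuousAt.eventually_lt continuousAt_const (lt_add_one _)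
  obtain ⟨δ₁, hδ₁, H1⟩ := Metric.nhds_basis_closedBall.eventually_iff.1 h1
  obtain ⟨δ₂, hδ₂, H2⟩ := Metric.nhds_basis_closedBall.eventually_iff.1 hfc
  refine ⟨min (min δ₁ δ₂) 1, by positivity, ?_⟩
  intro z y hy hδ v w hw
  obtain ⟨ν, hν, hyν⟩ := hy
  rcases hw with ⟨hnd, μ, hμ, hT⟩ | ⟨-, rfl, rfl⟩
  swap
  · simp
  rw [sub_zero] at hδ ⊢
  have n1 : ‖z - pair x₀ (g x₀)‖ ≤ ‖pair (z - pair x₀ (g x₀)) y‖ := WithLp.norm_fst_le _ (pair _ y)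
  have n2 : ‖y‖ ≤ ‖pair (z - pair x₀ (g x₀)) y‖ := WithLp.norm_snd_le _ (pair _ y)
  have n3 : ‖z.fst - x₀‖ ≤ ‖z - pair x₀ (g x₀)‖ := WithLp.norm_fst_le _ (z - pair x₀ (g x₀))
  have n4 : ‖z.snd - g x₀‖ ≤ ‖z - pair x₀ (g x₀)‖ := WithLp.norm_snd_le _ (z - pair x₀ (g x₀))
  have n5 : ‖y.fst‖ ≤ ‖y‖ := WithLp.norm_fst_le _ y
  have n6 : ‖v‖ ≤ ‖pair w v‖ := WithLp.norm_snd_le _ (pair w v)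
  obtain ⟨hδ', d3⟩ := le_min_iff.1 hδ
  obtain ⟨d1, d2⟩ := le_min_iff.1 hδ'
  have hfx := H2 (mem_closedBall_iff_norm.2 (n3.trans (n1.trans d2)))
  have hball : μ ∈ Metric.closedBall (0 : EuclideanSpace ℝ (Fin s)) R := by
    rw [mem_closedBall_zero_iff, hR, le_div_iff₀ hγ, mul_comm]
    refine (hnd μ (Submodule.subset_span hμ.1)).trans ?_
    have : gradT g z.fst μ = y.fst - f z.fst := by rw [hμ.2, Lag, add_sub_cancel_left]
    rw [this]
    have := norm_sub_le y.fst (f z.fst)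
    linarith
  have hmem : (z.fst, z.snd, y.fst) ∈ Metric.closedBall (x₀, g x₀, (0 : EuclideanSpace ℝ (Fin n))) δ₁ := by
    rw [Metric.mem_closedBall, Prod.dist_eq, Prod.dist_eq]
    simp only [dist_eq_norm, sub_zero]
    exact max_le (by linarith) (max_le (by linarith) (by linarith))
  have key := H1 hmem μ hball hμ v.fst v.snd w hT
  have hysnd : y.snd = g z.fst - z.snd := by rw [hyν]; rfl
  rw [← hysnd] at key
  change |⟪w, z - pair x₀ (g x₀)⟫ - ⟪v, y⟫| ≤ ε * ‖z.fst - x₀‖ * ‖v‖ at key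
  refine key.trans ?_
  gcongr
  exact n3.trans n1
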